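/- Let $K$ be a field of characteristic zero. A line arrangement $\mathcal A$ in $\mathbf P^2$ over $K$ is a finite set of lines in $\mathbf P^2$, that is, of two-dimensional linear subspaces of $V=K^3$. Let $L_2(\mathcal A)$ be the set of intersection points of $\mathcal A$, i.e. the codimension-two subspaces of $V$ which are intersections of members of $\mathcal A$. For a point $q$ let $\mathcal A_q=\{H\in\mathcal A : q\in H\}$ and, for $q\in L_2(\mathcal A)$, $\mu(q)=|\mathcal A_q|-1$. Let $n_2(\mathcal A)=|\{q\in L_2(\mathcal A):\mu(q)=1\}|$ be the number of double points. A point $p\in L_2(\mathcal A)$ is called modular if for all distinct $H,L\in\mathcal A\setminus\mathcal A_p$ there is a unique $M\in\mathcal A_p$ with $H\cap L\subset M$, and $\mathcal A$ is called supersolvable if it has a modular point. Let $S=K[x,y,z]$, let $\alpha_H$ be a linear form defining $H$, and let $D(\mathcal A)=\{\theta\in\operatorname{Der}_K S : \theta(\alpha_H)\in S\alpha_H \text{ for all } H\in\mathcal A\}$. We say that $\mathcal A$ is free with exponents $(1,d_2,d_3)$ if the $S$-module $D(\mathcal A)$ has a basis consisting of the Euler derivation $x\partial_x+y\partial_y+z\partial_z$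 and two derivations that are homogeneous of degrees $d_2$ and $d_3$ (a derivation is homogeneous of degree $d$ if it maps $x,y,z$ to homogeneous polynomials of degree $d$). Let $\mathcal A$ be a supersolvable line arrangement in $\mathbf P^2$ over $K$ with $|\mathcal A|=m+k$, $k\ge 1$, and let $p\in L_2(\mathcal A)$ be a modular point with $\mu(p)=m-1\ge 1$. Then $\mathcal A$ is free with exponents $(1,m-1,k)$, and the following hold. (1) If $k\le m$, then $n_2(\mathcal A)\ge k(m-k+1)$. (2) If $k\ge m$, then $n_2(\mathcal A)\ge k$. -/

import Mathlib

/-- A line arrangement in the projective plane over `K`: a finite set of lines of `ℙ²`, i.e. of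
two-dimensional linear subspaces of `V = K³`. -/
structure LineArrangement (K : Type*) [Field K] where
  lines : Finset (Submodule K (Fin 3 → K))
  finrank_eq_two : ∀ H ∈ lines, Module.finrank K H = 2

namespace LineArrangement

variable {K : Type*} [Field K]

open Classical in
/-- The intersection lattice `L(A)`: all `⋂_{H ∈ B} H` with `B ⊆ A`; the empty intersection
is `V`. -/
noncomputable def intersectionLattice (A : LineArrangement K) :
    Finset (Submodule K (Fin 3 → K)) :=
  A.lines.powerset.image (fun B => B.inf id)

open Classical in
/-- `L₂(A)`: the elements of `L(A)` of codimension two in `V = K³`, i.e. the intersection points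
of `A`, viewed as one-dimensional subspaces of `V`. -/
noncomputable def points (A : LineArrangement K) : Finset (Submodule K (Fin 3 → K)) :=
  A.intersectionLattice.filter (fun X => Module.finrank K X = 1)

open Classical in
/-- `A_p`: the lines of `A` through `p`. -/
noncomputable def linesThrough (A : LineArrangement K) (p : Submodule K (Fin 3 → K)) :
    Finset (Submodule K (Fin 3 → K)) :=
  A.lines.filter (fun H => p ≤ H)

/-- The Möbius function `μ(p) = |A_p| - 1`. -/
noncomputable def mu (A : LineArrangement K) (p : Submodule K (Fin 3 → K)) : ℤ :=
  ((A.linesThrough p).card : ℤ) - 1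

open Classical in
/-- `n₂(A)`: the number of double points of `A`, i.e. of points `q ∈ L₂(A)` with `μ(q) = 1`. -/
noncomputable def numDoublePoints (A : LineArrangement K) : ℕ :=
  (A.points.filter (fun q => A.mu q = 1)).card

/-- `p ∈ L₂(A)` is a modular point of `A` if for all distinct lines `H, L ∈ A ∖ A_p` there is a
unique line `M ∈ A_p` that contains the intersection point of `H` and `L`. -/
def IsModularPoint (A : LineArrangement K) (p : Submodule K (Fin 3 → K)) : Prop :=
  p ∈ A.points ∧
    ∀ H ∈ A.lines, ∀ L ∈ A.lines, H ∉ A.linesThrough p → L ∉ A.linesThrough p → H ≠ L →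
      ∃! M, M ∈ A.linesThrough p ∧ H ⊓ L ≤ M

/-- `A` is supersolvable if it has a modular point. -/
def IsSupersolvable (A : LineArrangement K) : Prop :=
  ∃ p, A.IsModularPoint p

/-- The linear form on `V = K³` given by `φ`, as an element of `S = K[x₀, x₁, x₂]`. -/
noncomputable def linearForm (φ : Module.Dual K (Fin 3 → K)) : MvPolynomial (Fin 3) K :=
  ∑ i, MvPolynomial.C (φ (Pi.single i 1)) * MvPolynomial.X i

/-- The module `D(A)` of logarithmic vector fields: the derivations `θ` of `S` with
`θ(α_H) ∈ S α_H` for every `H ∈ A`. The defining linear form `α_H` is determined up to a nonzero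
scalar, on which the condition does not depend; it is imposed for every choice. -/
noncomputable def logDerivations (A : LineArrangement K) :
    Submodule (MvPolynomial (Fin 3) K)
      (Derivation K (MvPolynomial (Fin 3) K) (MvPolynomial (Fin 3) K)) where
  carrier := {θ | ∀ H ∈ A.lines, ∀ φ : Module.Dual K (Fin 3 → K), LinearMap.ker φ = H →
    linearForm φ ∣ θ (linearForm φ)}
  add_mem' := fun ha hb H hH φ hφ => by
    rw [Derivation.add_apply]
    exact dvd_add (ha H hH φ hφ) (hb H hH φ hφ)
  zero_mem' := fun H _ φ _ => by
    rw [Derivation.zero_apply]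
    exact dvd_zero _
  smul_mem' := fun c θ hθ H hH φ hφ => by
    rw [Derivation.smul_apply, smul_eq_mul]
    exact Dvd.dvd.mul_left (hθ H hH φ hφ) c

/-- The Euler derivation `∑ xᵢ ∂/∂xᵢ`. -/
noncomputable def eulerDerivation (K : Type*) [Field K] :
    Derivation K (MvPolynomial (Fin 3) K) (MvPolynomial (Fin 3) K) :=
  MvPolynomial.mkDerivation K MvPolynomial.X

/-- A derivation of `S` is homogeneous of degree `d` if it maps the variables to homogeneous
polynomials of degree `d`. -/
def IsHomogeneousDerivation
    (θ : Derivation K (MvPolynomial (Fin 3) K) (MvPolynomial (Fin 3) K)) (d : ℕ) : Prop :=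
  ∀ i, (θ (MvPolynomial.X i)).IsHomogeneous d

/-- `A` is free with exponents `(1, d₂, d₃)`: the `S`-module `D(A)` has a basis consisting of the
Euler derivation and of homogeneous derivations of degrees `d₂` and `d₃`. -/
def IsFreeWithExponents (A : LineArrangement K) (d₂ d₃ : ℕ) : Prop :=
  ∃ b : Module.Basis (Fin 3) (MvPolynomial (Fin 3) K) A.logDerivations,
    (b 0 : Derivation K (MvPolynomial (Fin 3) K) (MvPolynomial (Fin 3) K)) = eulerDerivation K ∧
    IsHomogeneousDerivation (b 1 : Derivation K _ (MvPolynomial (Fin 3) K)) d₂ ∧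
    IsHomogeneousDerivation (b 2 : Derivation K _ (MvPolynomial (Fin 3) K)) d₃

end LineArrangement

/-! Choose coordinates `x, y, z` with the modular point at `x = y = 0`. The pencil lines `M ∈ P`
have forms α_M in `x, y` alone, the other lines `H ∈ N` have forms α_H with `z`-coefficient 1, and
modularity makes α_L - α_H a multiple of some α_M for `H ≠ L` in `N`. Let Q be the product of the
α_M and R that of the α_H; let E be the Euler field.

Freeness: the Hamiltonian field Q_y ∂_x - Q_x ∂_y is tangent to the pencil, and
`exists_tangent_correction` yields h such that θ₂ = Q_y ∂_x - Q_x ∂_y + h ∂_z is tangent to `N` too.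
The wedge xθ(y) - yθ(x) of a logarithmic field θ is a multiple of Q, and that of θ₂ is -|P| Q. So
subtracting multiples of θ₂ and E leaves a vertical field, which is a multiple of R ∂_z.

Double points: suppose every pencil line meets a given `H ∈ N` on a further `L ∈ N`. Subtracting a
multiple of E from θ₂ gives a field D killing α_H. Since α_L and α_M are proportional on H, D
restricted to H is tangent to order two to all pencil lines. Its degree |P| - 1 is too small for
that unless its wedge vanishes (`wedge_eq_zero_of_sq_dvd`), but the wedge is -|P| Q. Hence each `H`
carries a double point on a pencil line (`exists_line_forall_ne`), so n₂ ≥ k. Moreover each of the k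
- 1 other lines of `N` spoils at most one pencil line, so `H` carries at least m - k + 1 double
points. -/

open MvPolynomial Module

/-! ### Linear forms and derivations -/

namespace LineArrangement

variable {K : Type*} [Field K]

/-- The derivative in the direction of the vector `w`. -/
noncomputable def directionalDerivation (w : Fin 3 → K) :
    Derivation K (MvPolynomial (Fin 3) K) (MvPolynomial (Fin 3) K) :=
  mkDerivation K fun i => C (w i)

theorem linearForm_add (φ ψ : Dual K (Fin 3 → K)) :
    linearForm (φ + ψ) = linearForm φ + linearForm ψ := by
  simp [linearForm, add_mul, Finset.sum_add_distrib]

theorem linearForm_smul (c : K) (φ : Dual K (Fin 3 → K)) :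
    linearForm (c • φ) = C c * linearForm φ := by
  simp [linearForm, Finset.mul_sum, mul_assoc]

theorem linearForm_isHomogeneous (φ : Dual K (Fin 3 → K)) : (linearForm φ).IsHomogeneous 1 :=
  IsHomogeneous.sum _ _ _ fun i _ => (isHomogeneous_X K i).C_mul _

theorem sum_mul_apply_single (φ : Dual K (Fin 3 → K)) (w : Fin 3 → K) :
    ∑ i, φ (Pi.single i 1) * w i = φ w := by
  conv_rhs => rw [pi_eq_sum_univ' w]
  simp [mul_comm]

theorem derivation_linearForm
    (D : Derivation K (MvPolynomial (Fin 3) K) (MvPolynomial (Fin 3) K))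
    (φ : Dual K (Fin 3 → K)) :
    D (linearForm φ) = ∑ i, C (φ (Pi.single i 1)) * D (X i) := by
  simp [linearForm, C_mul']

theorem directionalDerivation_linearForm (w : Fin 3 → K) (φ : Dual K (Fin 3 → K)) :
    directionalDerivation w (linearForm φ) = C (φ w) := by
  rw [derivation_linearForm, ← sum_mul_apply_single φ w, map_sum]
  simp [directionalDerivation, mkDerivation_X]

theorem eulerDerivation_linearForm (φ : Dual K (Fin 3 → K)) :
    eulerDerivation K (linearForm φ) = linearForm φ := by
  rw [derivation_linearForm]
  simp [eulerDerivation, mkDerivation_X, linearForm]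

theorem linearForm_ne_zero {φ : Dual K (Fin 3 → K)} (hφ : φ ≠ 0) : linearForm φ ≠ 0 := by
  intro h
  refine hφ (LinearMap.ext fun w => ?_)
  have := directionalDerivation_linearForm w φ
  rw [h, map_zero] at this
  exact (C_eq_zero.1 this.symm)

/-! ### Restriction to a line and divisibility by its form -/

/-- Pulling back polynomials along the projection `x ↦ x - φ(x) w`. -/
noncomputable def projection (φ : Dual K (Fin 3 → K)) (w : Fin 3 → K) :
    MvPolynomial (Fin 3) K →ₐ[K] MvPolynomial (Fin 3) K :=
  aeval fun i => X i - C (w i) * linearForm φ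

theorem projection_linearForm (φ ψ : Dual K (Fin 3 → K)) (w : Fin 3 → K) :
    projection φ w (linearForm ψ) = linearForm ψ - C (ψ w) * linearForm φ := by
  rw [← sum_mul_apply_single ψ w]
  conv_lhs => rw [linearForm]
  simp only [projection, map_sum, map_mul, aeval_X, algHom_C, algebraMap_eq, mul_sub,
    Finset.sum_sub_distrib, Finset.sum_mul]
  simp [linearForm, mul_assoc]

theorem projection_isHomogeneous (φ : Dual K (Fin 3 → K)) (w : Fin 3 → K)
    {u : MvPolynomial (Fin 3) K} {d : ℕ} (hu : u.IsHomogeneous d) :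
    (projection φ w u).IsHomogeneous d := by
  have := hu.aeval (fun i => X i - C (w i) * linearForm φ) (n := 1)
    fun i => (isHomogeneous_X K i).sub ((linearForm_isHomogeneous φ).C_mul _)
  rwa [one_mul] at this

/-- Modulo the form of `φ` the substitution fixes every variable, so it induces the identity on the
quotient ring. -/
theorem linearForm_dvd_sub_projection (φ : Dual K (Fin 3 → K)) (w : Fin 3 → K)
    (u : MvPolynomial (Fin 3) K) : linearForm φ ∣ u - projection φ w u := by
  rw [← Ideal.mem_span_singleton, ← Ideal.Quotient.mk_eq_mk_iff_sub_mem]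
  have : (Ideal.Quotient.mkₐ K (Ideal.span {linearForm φ})) =
      (Ideal.Quotient.mkₐ K (Ideal.span {linearForm φ})).comp (projection φ w) := by
    refine algHom_ext fun i => ?_
    simp only [AlgHom.comp_apply, Ideal.Quotient.mkₐ_eq_mk]
    rw [Ideal.Quotient.mk_eq_mk_iff_sub_mem, Ideal.mem_span_singleton]
    simp [projection]
  exact DFunLike.congr_fun this u

/-- For `φ w = 1` the substitution is restriction to the plane `φ = 0`, pulled back along `w`; its
kernel is generated by the form. -/
theorem linearForm_dvd_iff {φ : Dual K (Fin 3 → K)} {w : Fin 3 → K} (hw : φ w = 1)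
    (u : MvPolynomial (Fin 3) K) : linearForm φ ∣ u ↔ projection φ w u = 0 := by
  constructor
  · rintro ⟨t, rfl⟩
    rw [map_mul, projection_linearForm, hw, C_1, one_mul, sub_self, zero_mul]
  · intro h
    simpa [h] using linearForm_dvd_sub_projection φ w u

theorem exists_apply_eq_one {φ : Dual K (Fin 3 → K)} (hφ : φ ≠ 0) : ∃ w, φ w = 1 := by
  obtain ⟨w, hw⟩ := DFunLike.ne_iff.1 hφ
  exact ⟨(φ w)⁻¹ • w, by simpa using inv_mul_cancel₀ hw⟩

/-- Divisibility by the form is vanishing under a ring endomorphism of a domain. -/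
theorem prime_linearForm {φ : Dual K (Fin 3 → K)} (hφ : φ ≠ 0) : Prime (linearForm φ) := by
  obtain ⟨w, hw⟩ := exists_apply_eq_one hφ
  refine ⟨linearForm_ne_zero hφ, fun h => ?_, fun a b hab => ?_⟩
  · have := (linearForm_dvd_iff hw 1).1 h.dvd
    simp at this
  · simpa [linearForm_dvd_iff hw] using hab

theorem linearForm_dvd_linearForm {φ ψ : Dual K (Fin 3 → K)} (hφ : φ ≠ 0)
    (h : linearForm φ ∣ linearForm ψ) : ∃ c : K, ψ = c • φ := by
  obtain ⟨w, hw⟩ := exists_apply_eq_one hφ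
  rw [linearForm_dvd_iff hw, projection_linearForm, ← linearForm_smul, sub_eq_zero] at h
  refine ⟨ψ w, LinearMap.ext fun x => C_injective (Fin 3) K ?_⟩
  rw [← directionalDerivation_linearForm, ← directionalDerivation_linearForm, h]

theorem isRelPrime_linearForm {φ ψ : Dual K (Fin 3 → K)} (hφ : φ ≠ 0)
    (h : ∀ c : K, ψ ≠ c • φ) : IsRelPrime (linearForm φ) (linearForm ψ) :=
  (prime_linearForm hφ).irreducible.isRelPrime_iff_not_dvd.2 fun hd =>
    (linearForm_dvd_linearForm hφ hd).elim h

/-! ### Homogeneity and coordinates -/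

theorem derivation_eq_sum_pderiv
    (D : Derivation K (MvPolynomial (Fin 3) K) (MvPolynomial (Fin 3) K))
    (u : MvPolynomial (Fin 3) K) : D u = ∑ i, D (X i) * pderiv i u := by
  have : D = D (X 0) • pderiv 0 + D (X 1) • pderiv 1 + D (X 2) • pderiv 2 :=
    derivation_ext fun j => by fin_cases j <;> simp
  conv_lhs => rw [this]
  simp [Fin.sum_univ_three]

theorem isHomogeneous_directionalDerivation (w : Fin 3 → K) {u : MvPolynomial (Fin 3) K} {d : ℕ}
    (hu : u.IsHomogeneous d) : (directionalDerivation w u).IsHomogeneous (d - 1) := by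
  rw [derivation_eq_sum_pderiv]
  refine IsHomogeneous.sum _ _ _ fun i _ => ?_
  rw [directionalDerivation, mkDerivation_X]
  exact hu.pderiv.C_mul _

theorem homogeneousComponent_linearForm_mul (φ : Dual K (Fin 3 → K)) (u : MvPolynomial (Fin 3) K)
    (d : ℕ) : linearForm φ ∣ homogeneousComponent d (linearForm φ * u) := by
  rw [← sum_homogeneousComponent u, Finset.mul_sum, map_sum]
  refine Finset.dvd_sum fun i _ => ?_
  rw [homogeneousComponent_of_mem
    ((linearForm_isHomogeneous φ).mul (homogeneousComponent_isHomogeneous i u))]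
  split_ifs
  · exact dvd_mul_right _ _
  · exact dvd_zero _

theorem linearForm_dvd_homogeneousComponent {φ : Dual K (Fin 3 → K)}
    {u : MvPolynomial (Fin 3) K} (h : linearForm φ ∣ u) (d : ℕ) :
    linearForm φ ∣ homogeneousComponent d u := by
  obtain ⟨t, rfl⟩ := h
  exact homogeneousComponent_linearForm_mul φ t d

theorem exists_isHomogeneous_of_linearForm_dvd {φ : Dual K (Fin 3 → K)}
    {u : MvPolynomial (Fin 3) K} {d : ℕ} (hu : u.IsHomogeneous (d + 1)) (h : linearForm φ ∣ u) :
    ∃ t : MvPolynomial (Fin 3) K, t.IsHomogeneous d ∧ u = linearForm φ * t := by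
  obtain ⟨t, rfl⟩ := h
  refine ⟨homogeneousComponent d t, homogeneousComponent_isHomogeneous d t, ?_⟩
  have h1 := homogeneousComponent_eq_self hu
  conv_lhs => rw [← h1]
  conv_lhs => rw [← sum_homogeneousComponent t, Finset.mul_sum, map_sum]
  have h2 : ∀ i, homogeneousComponent (d + 1) (linearForm φ * homogeneousComponent i t) =
      if d = i then linearForm φ * homogeneousComponent i t else 0 := fun i => by
    rw [homogeneousComponent_of_mem
      ((linearForm_isHomogeneous φ).mul (homogeneousComponent_isHomogeneous i t))]
    simp only [add_comm 1 i, add_left_inj]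
  simp only [h2, Finset.sum_ite_eq, Finset.mem_range]
  split_ifs with h3
  · rfl
  · rw [homogeneousComponent_eq_zero _ _ (by omega), mul_zero]

theorem exists_eq_smul_of_ker_le {φ ψ : Dual K (Fin 3 → K)} (hφ : φ ≠ 0)
    (h : LinearMap.ker φ ≤ LinearMap.ker ψ) : ∃ c : K, ψ = c • φ := by
  obtain ⟨w, hw⟩ := exists_apply_eq_one hφ
  refine ⟨ψ w, LinearMap.ext fun x => ?_⟩
  have hx : x - φ x • w ∈ LinearMap.ker φ := by simp [hw]
  have := h hx
  rw [LinearMap.mem_ker, map_sub, map_smul, sub_eq_zero] at this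
  rw [this, LinearMap.smul_apply, smul_eq_mul, smul_eq_mul, mul_comm]

theorem linearForm_eq_sum (v : Basis (Fin 3) K (Fin 3 → K)) (φ : Dual K (Fin 3 → K)) :
    linearForm φ = C (φ (v 0)) * linearForm (v.coord 0) + C (φ (v 1)) * linearForm (v.coord 1) +
      C (φ (v 2)) * linearForm (v.coord 2) := by
  simp only [← linearForm_smul, ← linearForm_add]
  congr 1
  refine v.ext fun i => ?_
  fin_cases i <;> simp

theorem derivation_ext_coord (v : Basis (Fin 3) K (Fin 3 → K))
    {D₁ D₂ : Derivation K (MvPolynomial (Fin 3) K) (MvPolynomial (Fin 3) K)}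
    (h : ∀ i, D₁ (linearForm (v.coord i)) = D₂ (linearForm (v.coord i))) : D₁ = D₂ := by
  refine derivation_ext fun j => ?_
  have hX : (X j : MvPolynomial (Fin 3) K) = linearForm (LinearMap.proj j) := by
    simp [linearForm, Pi.single_apply]
  rw [hX, linearForm_eq_sum v]
  simp [h]

theorem directionalDerivation_coord (v : Basis (Fin 3) K (Fin 3 → K)) (i j : Fin 3) :
    directionalDerivation (v i) (linearForm (v.coord j)) = if i = j then 1 else 0 := by
  rw [directionalDerivation_linearForm]
  by_cases h : i = j <;> simp [h]

theorem dvd_of_dvd_C_mul {u t : MvPolynomial (Fin 3) K} {a : K} (ha : a ≠ 0) (h : u ∣ C a * t) :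
    u ∣ t := by
  have := h.mul_left (C a⁻¹)
  rwa [← mul_assoc, ← C_mul, inv_mul_cancel₀ ha, C_1, one_mul] at this

/-! ### Tangency to a pencil and its extension to further lines -/

/-- If a vector field `(p, q)` in the plane with coordinates `x, y` is tangent to the line
`ax + by = 0`, then its wedge product with the Euler field vanishes along this line. -/
theorem dvd_wedge {a b : K} (hab : a ≠ 0 ∨ b ≠ 0) {x y p q : MvPolynomial (Fin 3) K}
    (h : C a * x + C b * y ∣ C a * p + C b * q) : C a * x + C b * y ∣ x * q - y * p := by
  rcases hab with ha | hb
  · refine dvd_of_dvd_C_mul ha ?_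
    have : C a * (x * q - y * p) = (C a * x + C b * y) * q - y * (C a * p + C b * q) := by ring
    rw [this]
    exact dvd_sub (dvd_mul_right _ _) (h.mul_left _)
  · refine dvd_of_dvd_C_mul hb ?_
    have : C b * (x * q - y * p) = x * (C a * p + C b * q) - (C a * x + C b * y) * p := by ring
    rw [this]
    exact dvd_sub (h.mul_left _) (dvd_mul_right _ _)

theorem derivation_prod_of_forall_eq_self {ι : Type*} (s : Finset ι)
    (f : ι → MvPolynomial (Fin 3) K)
    (D : Derivation K (MvPolynomial (Fin 3) K) (MvPolynomial (Fin 3) K))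
    (h : ∀ i ∈ s, D (f i) = f i) : D (∏ i ∈ s, f i) = s.card • ∏ i ∈ s, f i := by
  classical
  induction s using Finset.induction_on with
  | empty => simp
  | insert a s ha ih =>
    rw [Finset.prod_insert ha, Derivation.leibniz, ih fun i hi => h i (Finset.mem_insert_of_mem hi),
      h a (Finset.mem_insert_self a s), Finset.card_insert_of_notMem ha]
    simp only [smul_eq_mul, nsmul_eq_mul]
    push_cast
    ring

/-- A derivation tangent to the lines of a pencil can be corrected along the vertex `w` of the
pencil so as to be tangent to further lines whose mutual intersections lie on the pencil. -/
theorem exists_tangent_correction {ι : Type*} {w : Fin 3 → K} {P : Finset ι}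
    {φ : ι → Dual K (Fin 3 → K)} (hP : ∀ M ∈ P, φ M ≠ 0)
    (hPind : ∀ M ∈ P, ∀ M' ∈ P, M ≠ M' → ∀ c : K, φ M' ≠ c • φ M)
    (G : Derivation K (MvPolynomial (Fin 3) K) (MvPolynomial (Fin 3) K))
    (hG : ∀ M ∈ P, linearForm (φ M) ∣ G (linearForm (φ M))) (N : Finset ι)
    (hNw : ∀ H ∈ N, φ H w = 1) (hinj : ∀ H ∈ N, ∀ L ∈ N, H ≠ L → φ H ≠ φ L)
    (hmod : ∀ H ∈ N, ∀ L ∈ N, H ≠ L → ∃ M ∈ P, ∃ c : K, φ L = φ H + c • φ M) :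
    ∃ h, ∀ H ∈ N, linearForm (φ H) ∣ G (linearForm (φ H)) + h := by
  classical
  induction N using Finset.induction_on with
  | empty => exact ⟨0, by simp⟩
  | insert H T hHT ih =>
    have hT : ∀ L ∈ T, L ∈ insert H T := fun L hL => Finset.mem_insert_of_mem hL
    have hH : H ∈ insert H T := Finset.mem_insert_self H T
    obtain ⟨h, hh⟩ := ih (fun L hL => hNw L (hT L hL))
      (fun L hL L' hL' => hinj L (hT L hL) L' (hT L' hL'))
      (fun L hL L' hL' => hmod L (hT L hL) L' (hT L' hL'))
    have hne : ∀ L ∈ T, H ≠ L := fun L hL e => hHT (e ▸ hL)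
    -- The values `L` and `0` outside `T` are placeholders that make `choose` give total functions.
    have hmod' : ∀ L, ∃ M, ∃ c : K, L ∈ T → M ∈ P ∧ φ L = φ H + c • φ M := fun L => by
      by_cases hL : L ∈ T
      · obtain ⟨M, hM, c, hc⟩ := hmod H hH L (hT L hL) (hne L hL)
        exact ⟨M, c, fun _ => ⟨hM, hc⟩⟩
      · exact ⟨L, 0, fun h => absurd h hL⟩
    choose M c hMc using hmod'
    have hc : ∀ L ∈ T, c L ≠ 0 := fun L hL h0 => by
      have := (hMc L hL).2
      rw [h0, zero_smul, add_zero] at this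
      exact hinj H hH L (hT L hL) (hne L hL) this.symm
    have hproj : ∀ L ∈ T, projection (φ H) w (linearForm (φ L)) = linearForm (c L • φ (M L)) := by
      intro L hL
      rw [projection_linearForm, hNw L (hT L hL), C_1, one_mul, (hMc L hL).2, linearForm_add,
        add_sub_cancel_left]
    -- On `H` each further form becomes a multiple of a pencil form. Lines with different pencil
    -- lines give coprime factors, so it suffices to treat the lines `L` with a common `M L = M₁`.
    have hdvd : (∏ L ∈ T, linearForm (c L • φ (M L))) ∣
        projection (φ H) w (G (linearForm (φ H)) + h) := by
      rw [← Finset.prod_fiberwise_of_maps_to (t := P) (g := M) fun L hL => (hMc L hL).1]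
      refine Finset.prod_dvd_of_isRelPrime ?_ ?_
      · intro M₁ hM₁ M₂ hM₂ hM
        refine IsRelPrime.prod_left fun L₁ hL₁ => IsRelPrime.prod_right fun L₂ hL₂ => ?_
        rw [Finset.mem_filter] at hL₁ hL₂
        refine isRelPrime_linearForm (smul_ne_zero (hc L₁ hL₁.1) (hP _ (hMc L₁ hL₁.1).1)) ?_
        intro d hd
        rw [hL₁.2, hL₂.2] at hd
        refine hPind M₁ hM₁ M₂ hM₂ hM ((c L₂)⁻¹ * d * c L₁) ?_
        rw [mul_assoc, mul_smul, mul_smul, ← hd, inv_smul_smul₀ (hc L₂ hL₂.1)]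
      · intro M₁ hM₁
        obtain ⟨g, hg⟩ := hG M₁ hM₁
        -- With `G(α_M₁) = α_M₁ g`, the expression `G(α) + h - α g` is the same for `α_H` and for
        -- all `α_L` of this group, and each `α_L` divides it.
        have key : (∏ L ∈ T with M L = M₁, linearForm (φ L)) ∣
            G (linearForm (φ H)) + h - linearForm (φ H) * g := by
          refine Finset.prod_dvd_of_isRelPrime ?_ ?_
          · intro L₁ hL₁ L₂ hL₂ hL
            rw [Finset.mem_coe, Finset.mem_filter] at hL₁ hL₂
            have h1 := hNw L₁ (hT L₁ hL₁.1)
            have h2 := hNw L₂ (hT L₂ hL₂.1)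
            refine isRelPrime_linearForm (fun h0 => by simp [h0] at h1) fun d hd => ?_
            have h3 : d = 1 := by simpa [h1, h2] using (LinearMap.congr_fun hd w).symm
            rw [h3, one_smul] at hd
            exact hinj L₁ (hT L₁ hL₁.1) L₂ (hT L₂ hL₂.1) hL hd.symm
          · intro L hL
            rw [Finset.mem_filter] at hL
            have h1 := hh L hL.1
            have h2 : linearForm (φ L) = linearForm (φ H) + C (c L) * linearForm (φ M₁) := by
              rw [← linearForm_smul, ← linearForm_add, ← hL.2, ← (hMc L hL.1).2]
            have h3 : G (linearForm (φ H)) + h - linearForm (φ H) * g =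
                (G (linearForm (φ L)) + h) - linearForm (φ L) * g := by
              rw [h2, map_add, ← smul_eq_C_mul, Derivation.map_smul, hg, smul_eq_C_mul,
                smul_eq_C_mul]
              ring
            rw [h3]
            exact dvd_sub h1 (dvd_mul_right _ _)
        have := map_dvd (projection (φ H) w) key
        rw [map_prod, map_sub, map_mul, projection_linearForm, hNw H hH, C_1, one_mul, sub_self,
          zero_mul, sub_zero] at this
        refine dvd_trans (dvd_of_eq (Finset.prod_congr rfl fun L hL => ?_)) this
        exact (hproj L (Finset.mem_filter.1 hL).1).symm
    rw [← Finset.prod_congr rfl hproj, ← map_prod] at hdvd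
    obtain ⟨s, hs⟩ := hdvd
    -- Newton interpolation: the added term vanishes on the lines of `T`, and `s` is chosen to
    -- cancel the value on `H`.
    refine ⟨h - s * ∏ L ∈ T, linearForm (φ L), fun L hL => ?_⟩
    rw [← add_sub_assoc]
    rcases Finset.mem_insert.1 hL with rfl | hL
    · have h1 := linearForm_dvd_sub_projection (φ L) w (G (linearForm (φ L)) + h)
      have h2 := linearForm_dvd_sub_projection (φ L) w (∏ L ∈ T, linearForm (φ L))
      have := dvd_sub h1 (h2.mul_left s)
      rw [hs] at this
      refine this.trans (dvd_of_eq ?_)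
      ring
    · exact dvd_sub (hh L hL) ((Finset.dvd_prod_of_mem _ hL).mul_left _)

/-- Three elements of a submodule which are independent and span it form a basis. -/
theorem exists_basis_fin_three {R M : Type*} [CommRing R] [AddCommGroup M] [Module R M]
    (D : Submodule R M) {b₀ b₁ b₂ : M} (h₀ : b₀ ∈ D) (h₁ : b₁ ∈ D) (h₂ : b₂ ∈ D)
    (hli : ∀ r s t : R, r • b₀ + s • b₁ + t • b₂ = 0 → r = 0 ∧ s = 0 ∧ t = 0)
    (hsp : ∀ m ∈ D, ∃ r s t : R, m = r • b₀ + s • b₁ + t • b₂) :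
    ∃ b : Basis (Fin 3) R D, (b 0 : M) = b₀ ∧ (b 1 : M) = b₁ ∧ (b 2 : M) = b₂ := by
  let b : Fin 3 → D := ![⟨b₀, h₀⟩, ⟨b₁, h₁⟩, ⟨b₂, h₂⟩]
  have hb : LinearIndependent R b := by
    refine Fintype.linearIndependent_iff.2 fun g hg => ?_
    rw [Fin.sum_univ_three] at hg
    obtain ⟨e₀, e₁, e₂⟩ := hli _ _ _ (congrArg Subtype.val hg)
    intro i
    fin_cases i <;> assumption
  have hspan : ⊤ ≤ Submodule.span R (Set.range b) := by
    rintro ⟨m, hm⟩ -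
    obtain ⟨r, s, t, hrst⟩ := hsp m hm
    have : (⟨m, hm⟩ : D) = r • b 0 + s • b 1 + t • b 2 := Subtype.ext hrst
    rw [this]
    have hmem : ∀ i, b i ∈ Submodule.span R (Set.range b) := fun i =>
      Submodule.subset_span ⟨i, rfl⟩
    exact add_mem (add_mem (Submodule.smul_mem _ _ (hmem 0)) (Submodule.smul_mem _ _ (hmem 1)))
      (Submodule.smul_mem _ _ (hmem 2))
  exact ⟨Basis.mk hb hspan, by rw [Basis.mk_apply]; rfl, by rw [Basis.mk_apply]; rfl,
    by rw [Basis.mk_apply]; rfl⟩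

/-! ### Normalized forms and freeness -/

/-- Normalized defining forms `φ` of the lines of an arrangement with a modular point spanned by
`v 2`; the lines through this point are the members of `P`, the others are those of `N`. -/
structure ModularForms (A : LineArrangement K) (v : Basis (Fin 3) K (Fin 3 → K))
    (P N : Finset (Submodule K (Fin 3 → K)))
    (φ : Submodule K (Fin 3 → K) → Dual K (Fin 3 → K)) : Prop where
  mem_lines : ∀ H, H ∈ A.lines ↔ H ∈ P ∨ H ∈ N
  ker : ∀ H ∈ A.lines, LinearMap.ker (φ H) = H
  apply_of_mem_P : ∀ M ∈ P, φ M (v 2) = 0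
  apply_of_mem_N : ∀ H ∈ N, φ H (v 2) = 1
  modular : ∀ H ∈ N, ∀ L ∈ N, H ≠ L → ∃ M ∈ P, ∃ c : K, φ L = φ H + c • φ M

namespace ModularForms

variable {A : LineArrangement K} {v : Basis (Fin 3) K (Fin 3 → K)}
  {P N : Finset (Submodule K (Fin 3 → K))} {φ : Submodule K (Fin 3 → K) → Dual K (Fin 3 → K)}

theorem mem_of_mem_P (F : ModularForms A v P N φ) {M} (hM : M ∈ P) : M ∈ A.lines :=
  (F.mem_lines M).2 (Or.inl hM)

theorem mem_of_mem_N (F : ModularForms A v P N φ) {H} (hH : H ∈ N) : H ∈ A.lines :=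
  (F.mem_lines H).2 (Or.inr hH)

theorem ne_zero (F : ModularForms A v P N φ) {H} (hH : H ∈ A.lines) : φ H ≠ 0 := by
  intro h
  have h1 := F.ker H hH
  rw [h, LinearMap.ker_zero] at h1
  have h2 := A.finrank_eq_two H hH
  rw [← h1, finrank_top] at h2
  simp at h2

theorem ne_smul (F : ModularForms A v P N φ) {H L} (hH : H ∈ A.lines) (hL : L ∈ A.lines)
    (hHL : H ≠ L) (c : K) : φ L ≠ c • φ H := by
  intro h
  have hc : c ≠ 0 := by
    rintro rfl
    exact F.ne_zero hL (by rw [h, zero_smul])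
  refine hHL ?_
  rw [← F.ker H hH, ← F.ker L hL, h, LinearMap.ker_smul _ _ hc]

theorem mem_logDerivations_iff (F : ModularForms A v P N φ)
    (θ : Derivation K (MvPolynomial (Fin 3) K) (MvPolynomial (Fin 3) K)) :
    θ ∈ A.logDerivations ↔ ∀ H ∈ A.lines, linearForm (φ H) ∣ θ (linearForm (φ H)) := by
  constructor
  · exact fun h H hH => h H hH (φ H) (F.ker H hH)
  · intro h H hH ψ hψ
    obtain ⟨c, rfl⟩ := exists_eq_smul_of_ker_le (F.ne_zero hH)
      ((F.ker H hH).trans hψ.symm).le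
    rw [linearForm_smul, ← smul_eq_C_mul, Derivation.map_smul, smul_eq_C_mul, smul_eq_C_mul]
    exact mul_dvd_mul_left _ (h H hH)

theorem linearForm_of_mem_P (F : ModularForms A v P N φ) {M} (hM : M ∈ P) :
    linearForm (φ M) = C (φ M (v 0)) * linearForm (v.coord 0) +
      C (φ M (v 1)) * linearForm (v.coord 1) := by
  conv_lhs => rw [linearForm_eq_sum v, F.apply_of_mem_P M hM, C_0, zero_mul, add_zero]

theorem apply_ne_zero_of_mem_P (F : ModularForms A v P N φ) {M} (hM : M ∈ P) :
    φ M (v 0) ≠ 0 ∨ φ M (v 1) ≠ 0 := by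
  by_contra! h
  refine linearForm_ne_zero (F.ne_zero (F.mem_of_mem_P hM)) ?_
  rw [F.linearForm_of_mem_P hM, h.1, h.2, C_0, zero_mul, zero_mul, add_zero]

theorem pairwise_isRelPrime (F : ModularForms A v P N φ) {s : Finset (Submodule K (Fin 3 → K))}
    (hs : ∀ H ∈ s, H ∈ A.lines) :
    (s : Set (Submodule K (Fin 3 → K))).Pairwise
      (Function.onFun IsRelPrime fun H => linearForm (φ H)) :=
  fun H hH L hL hHL => isRelPrime_linearForm (F.ne_zero (hs H hH))
    (F.ne_smul (hs H hH) (hs L hL) hHL)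

/-- A vector field `(p, q)` tangent to all lines of the pencil wedges with the Euler field to a
multiple of the defining polynomial of the pencil. -/
theorem prod_dvd_wedge (F : ModularForms A v P N φ) {p q : MvPolynomial (Fin 3) K}
    (h : ∀ M ∈ P, linearForm (φ M) ∣ C (φ M (v 0)) * p + C (φ M (v 1)) * q) :
    (∏ M ∈ P, linearForm (φ M)) ∣ linearForm (v.coord 0) * q - linearForm (v.coord 1) * p := by
  refine Finset.prod_dvd_of_isRelPrime (F.pairwise_isRelPrime fun M => F.mem_of_mem_P)
    fun M hM => ?_
  have := h M hM
  rw [F.linearForm_of_mem_P hM] at this ⊢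
  exact dvd_wedge (F.apply_ne_zero_of_mem_P hM) this

theorem prod_isHomogeneous (φ : Submodule K (Fin 3 → K) → Dual K (Fin 3 → K))
    (s : Finset (Submodule K (Fin 3 → K))) :
    (∏ H ∈ s, linearForm (φ H)).IsHomogeneous s.card := by
  have := IsHomogeneous.prod s (fun H => linearForm (φ H)) (fun _ => 1)
    fun H _ => linearForm_isHomogeneous (φ H)
  simpa using this

theorem prod_ne_zero (F : ModularForms A v P N φ) {s : Finset (Submodule K (Fin 3 → K))}
    (hs : ∀ H ∈ s, H ∈ A.lines) : (∏ H ∈ s, linearForm (φ H)) ≠ 0 :=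
  Finset.prod_ne_zero_iff.2 fun H hH => linearForm_ne_zero (F.ne_zero (hs H hH))

/-- Euler's identity in two variables: every factor is a linear form in the first two coordinates.
-/
theorem euler_prod_P (F : ModularForms A v P N φ) :
    linearForm (v.coord 0) * directionalDerivation (v 0) (∏ M ∈ P, linearForm (φ M)) +
      linearForm (v.coord 1) * directionalDerivation (v 1) (∏ M ∈ P, linearForm (φ M)) =
      P.card • ∏ M ∈ P, linearForm (φ M) := by
  have := derivation_prod_of_forall_eq_self P (fun M => linearForm (φ M))
    (linearForm (v.coord 0) • directionalDerivation (v 0) +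
      linearForm (v.coord 1) • directionalDerivation (v 1)) fun M hM => by
    rw [Derivation.add_apply, Derivation.smul_apply, Derivation.smul_apply,
      directionalDerivation_linearForm, directionalDerivation_linearForm, smul_eq_mul, smul_eq_mul,
      F.linearForm_of_mem_P hM]
    ring
  exact this

/-- By the product rule, the two terms in which the factor of `M` is differentiated cancel; all
others retain that factor. -/
theorem dvd_hamiltonian (v : Basis (Fin 3) K (Fin 3 → K))
    (φ : Submodule K (Fin 3 → K) → Dual K (Fin 3 → K)) {M} (hM : M ∈ P) :
    linearForm (φ M) ∣
      C (φ M (v 0)) * directionalDerivation (v 1) (∏ M ∈ P, linearForm (φ M)) +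
      C (φ M (v 1)) * -directionalDerivation (v 0) (∏ M ∈ P, linearForm (φ M)) := by
  classical
  rw [← Finset.mul_prod_erase P _ hM]
  simp only [Derivation.leibniz, directionalDerivation_linearForm, smul_eq_mul]
  refine ⟨C (φ M (v 0)) * directionalDerivation (v 1) (∏ M ∈ P.erase M, linearForm (φ M)) -
    C (φ M (v 1)) * directionalDerivation (v 0) (∏ M ∈ P.erase M, linearForm (φ M)), ?_⟩
  ring

/-- The vertical coefficient of a logarithmic derivation extending the Hamiltonian vector field of
the defining polynomial of the pencil of lines through the modular point. -/
theorem exists_vertical_coefficient (F : ModularForms A v P N φ) :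
    ∃ h : MvPolynomial (Fin 3) K, h.IsHomogeneous (P.card - 1) ∧ ∀ H ∈ N, linearForm (φ H) ∣
      C (φ H (v 0)) * directionalDerivation (v 1) (∏ M ∈ P, linearForm (φ M)) +
      C (φ H (v 1)) * -directionalDerivation (v 0) (∏ M ∈ P, linearForm (φ M)) + h := by
  set Q := ∏ M ∈ P, linearForm (φ M) with hQ
  have hG : ∀ ψ : Dual K (Fin 3 → K), (directionalDerivation (v 1) Q • directionalDerivation (v 0) +
      (-directionalDerivation (v 0) Q) • directionalDerivation (v 1)) (linearForm ψ) =
      C (ψ (v 0)) * directionalDerivation (v 1) Q +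
        C (ψ (v 1)) * -directionalDerivation (v 0) Q := fun ψ => by
    rw [Derivation.add_apply, Derivation.smul_apply, Derivation.smul_apply,
      directionalDerivation_linearForm, directionalDerivation_linearForm, smul_eq_mul, smul_eq_mul]
    ring
  obtain ⟨h, hh⟩ := exists_tangent_correction (w := v 2) (P := P) (φ := φ)
    (fun M hM => F.ne_zero (F.mem_of_mem_P hM))
    (fun M hM M' hM' hne => F.ne_smul (F.mem_of_mem_P hM) (F.mem_of_mem_P hM') hne)
    (directionalDerivation (v 1) Q • directionalDerivation (v 0) +
      (-directionalDerivation (v 0) Q) • directionalDerivation (v 1))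
    (fun M hM => by rw [hG]; exact dvd_hamiltonian v φ hM) N F.apply_of_mem_N
    (fun H hH L hL hne h => F.ne_smul (F.mem_of_mem_N hH) (F.mem_of_mem_N hL) hne 1
      (by rw [one_smul, h])) F.modular
  -- The Hamiltonian part is homogeneous of degree `P.card - 1`, and divisibility by a linear form
  -- passes to homogeneous components, so the other components of `h` can be dropped.
  refine ⟨homogeneousComponent (P.card - 1) h, homogeneousComponent_isHomogeneous _ _,
    fun H hH => ?_⟩
  have h1 := linearForm_dvd_homogeneousComponent (hh H hH) (P.card - 1)
  have h2 : (C (φ H (v 0)) * directionalDerivation (v 1) Q +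
      C (φ H (v 1)) * -directionalDerivation (v 0) Q).IsHomogeneous (P.card - 1) := by
    have hQh : Q.IsHomogeneous P.card := prod_isHomogeneous φ P
    exact ((isHomogeneous_directionalDerivation _ hQh).C_mul _).add
      ((isHomogeneous_directionalDerivation _ hQh).neg.C_mul _)
  rwa [hG, map_add, homogeneousComponent_eq_self h2] at h1

/-- The basis is E, θ₂, R ∂_z. The wedge with E in the first two coordinates detects the
θ₂-coefficient; characteristic zero enters through division by `P.card`. -/
theorem isFreeWithExponents [CharZero K] (F : ModularForms A v P N φ) (hP : P.Nonempty) :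
    A.IsFreeWithExponents (P.card - 1) N.card := by
  obtain ⟨h, hhom, hh⟩ := F.exists_vertical_coefficient
  set Q := ∏ M ∈ P, linearForm (φ M) with hQ
  set R := ∏ H ∈ N, linearForm (φ H) with hR
  have hQh : Q.IsHomogeneous P.card := prod_isHomogeneous φ P
  have hRh : R.IsHomogeneous N.card := prod_isHomogeneous φ N
  have hQ0 : Q ≠ 0 := F.prod_ne_zero fun M => F.mem_of_mem_P
  have hR0 : R ≠ 0 := F.prod_ne_zero fun H => F.mem_of_mem_N
  have hcard : (P.card : K) ≠ 0 := by simpa using hP.ne_empty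
  have heuler := F.euler_prod_P
  rw [← hQ, nsmul_eq_mul] at heuler
  set Q₀ := directionalDerivation (v 0) Q
  set Q₁ := directionalDerivation (v 1) Q
  set x := linearForm (v.coord 0) with hx
  set y := linearForm (v.coord 1) with hy
  set z := linearForm (v.coord 2) with hz
  have hx0 : x ≠ 0 := linearForm_ne_zero fun h0 => by
    simpa using LinearMap.congr_fun h0 (v 0)
  have happly : ∀ (a b c : MvPolynomial (Fin 3) K) (ψ : Dual K (Fin 3 → K)),
      (a • directionalDerivation (v 0) + b • directionalDerivation (v 1) +
        c • directionalDerivation (v 2)) (linearForm ψ) =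
      C (ψ (v 0)) * a + C (ψ (v 1)) * b + C (ψ (v 2)) * c := fun a b c ψ => by
    simp only [Derivation.add_apply, Derivation.smul_apply, directionalDerivation_linearForm,
      smul_eq_mul]
    ring
  let θ₂ : Derivation K (MvPolynomial (Fin 3) K) (MvPolynomial (Fin 3) K) :=
    Q₁ • directionalDerivation (v 0) + (-Q₀) • directionalDerivation (v 1) +
      h • directionalDerivation (v 2)
  let θ₃ : Derivation K (MvPolynomial (Fin 3) K) (MvPolynomial (Fin 3) K) :=
    R • directionalDerivation (v 2)
  have hθ₁mem : eulerDerivation K ∈ A.logDerivations := (F.mem_logDerivations_iff _).2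
    fun H _ => by rw [eulerDerivation_linearForm]
  have hθ₂mem : θ₂ ∈ A.logDerivations := (F.mem_logDerivations_iff _).2 fun H hH => by
    rw [happly]
    rcases (F.mem_lines H).1 hH with hHP | hHN
    · rw [F.apply_of_mem_P H hHP, C_0, zero_mul, add_zero]
      exact dvd_hamiltonian v φ hHP
    · rw [F.apply_of_mem_N H hHN, C_1, one_mul]
      exact hh H hHN
  have hθ₃mem : θ₃ ∈ A.logDerivations := (F.mem_logDerivations_iff _).2 fun H hH => by
    rw [Derivation.smul_apply, directionalDerivation_linearForm, smul_eq_mul]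
    rcases (F.mem_lines H).1 hH with hHP | hHN
    · rw [F.apply_of_mem_P H hHP, C_0, mul_zero]
      exact dvd_zero _
    · exact (Finset.dvd_prod_of_mem _ hHN).mul_right _
  have hE : ∀ i, eulerDerivation K (linearForm (v.coord i)) = linearForm (v.coord i) :=
    fun i => eulerDerivation_linearForm _
  have h₂x : θ₂ x = Q₁ := by rw [hx, happly]; simp
  have h₂y : θ₂ y = -Q₀ := by rw [hy, happly]; simp
  have h₂z : θ₂ z = h := by rw [hz, happly]; simp
  have h₃ : ∀ i, θ₃ (linearForm (v.coord i)) = if 2 = i then R else 0 := fun i => by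
    rw [Derivation.smul_apply, directionalDerivation_coord]
    simp
  have h₃x : θ₃ x = 0 := h₃ 0
  have h₃y : θ₃ y = 0 := h₃ 1
  have h₃z : θ₃ z = R := h₃ 2
  have hli : ∀ r s t : MvPolynomial (Fin 3) K,
      r • eulerDerivation K + s • θ₂ + t • θ₃ = 0 → r = 0 ∧ s = 0 ∧ t = 0 := by
    intro r s t hg'
    have hval : ∀ u, r * eulerDerivation K u + s * θ₂ u + t * θ₃ u = 0 := fun u =>
      DFunLike.congr_fun hg' u
    have e0 := hval x
    have e1 := hval y
    have e2 := hval z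
    rw [hE, h₂x, h₃x] at e0
    rw [hE, h₂y, h₃y] at e1
    rw [hE, h₂z, h₃z] at e2
    -- The wedge removes the `r` and `t` terms and leaves `s` times `P.card * Q`.
    have g1 : s = 0 := by
      have : s * ((P.card : MvPolynomial (Fin 3) K) * Q) = 0 := by
        rw [← heuler]
        linear_combination y * e0 - x * e1
      refine (mul_eq_zero.1 this).resolve_right (mul_ne_zero ?_ hQ0)
      exact_mod_cast hP.card_pos.ne'
    have g0 : r = 0 := by
      rw [g1] at e0
      exact (mul_eq_zero.1 (by simpa using e0)).resolve_right hx0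
    have g2 : t = 0 := by
      rw [g0, g1] at e2
      exact (mul_eq_zero.1 (by simpa using e2)).resolve_right hR0
    exact ⟨g0, g1, g2⟩
  have hsp : ∀ θ ∈ A.logDerivations, ∃ r s t : MvPolynomial (Fin 3) K,
      θ = r • eulerDerivation K + s • θ₂ + t • θ₃ := by
    intro θ hθ
    have hθ' := (F.mem_logDerivations_iff θ).1 hθ
    have hform : ∀ ψ : Dual K (Fin 3 → K), θ (linearForm ψ) =
        C (ψ (v 0)) * θ x + C (ψ (v 1)) * θ y + C (ψ (v 2)) * θ z := fun ψ => by
      rw [linearForm_eq_sum v ψ]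
      simp [hx, hy, hz]
    obtain ⟨u, hu⟩ : Q ∣ x * θ y - y * θ x := F.prod_dvd_wedge fun M hM => by
      have := hθ' M (F.mem_of_mem_P hM)
      rwa [hform, F.apply_of_mem_P M hM, C_0, zero_mul, add_zero] at this
    have hinv : (C (P.card : K)⁻¹ : MvPolynomial (Fin 3) K) * (P.card : MvPolynomial (Fin 3) K)
        = 1 := by
      rw [← map_natCast C, ← C_mul, inv_mul_cancel₀ hcard, C_1]
    -- The wedge of `θ` is `Q * u` and that of `θ₂` is `-P.card * Q`, so `θ - g₁ • θ₂` has zero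
    -- wedge. As `x` and `y` are coprime, its horizontal part is then a multiple `w` of that of E.
    set g₁ := -(C (P.card : K)⁻¹ * u) with hg₁
    have hw : x * (θ y + g₁ * Q₀) = y * (θ x - g₁ * Q₁) := by
      rw [hg₁]
      linear_combination hu - C (P.card : K)⁻¹ * u * heuler - Q * u * hinv
    have hxy : IsRelPrime x y := isRelPrime_linearForm
      (fun h0 => hx0 (by rw [hx, h0]; simp [linearForm])) fun c hc => by
        simpa using LinearMap.congr_fun hc (v 1)
    obtain ⟨w, hw'⟩ : x ∣ θ x - g₁ * Q₁ :=
      hxy.dvd_of_dvd_mul_left (Dvd.intro _ hw)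
    have hwy : θ y + g₁ * Q₀ = y * w := by
      rw [hw'] at hw
      exact mul_left_cancel₀ hx0 (by linear_combination hw)
    -- The field `θ - g₁ • θ₂ - w • E` is vertical and logarithmic. Each form from `N` has
    -- `z`-coefficient 1, hence divides its only coefficient.
    obtain ⟨s, hs⟩ : R ∣ θ z - g₁ * h - w * z := by
      refine Finset.prod_dvd_of_isRelPrime (F.pairwise_isRelPrime fun M => F.mem_of_mem_N)
        fun H hH => ?_
      have hmem : θ - g₁ • θ₂ - w • eulerDerivation K ∈ A.logDerivations :=
        sub_mem (sub_mem hθ (Submodule.smul_mem _ _ hθ₂mem)) (Submodule.smul_mem _ _ hθ₁mem)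
      have := (F.mem_logDerivations_iff _).1 hmem H (F.mem_of_mem_N hH)
      refine this.trans (dvd_of_eq ?_)
      simp only [Derivation.sub_apply, Derivation.smul_apply, smul_eq_mul]
      rw [happly, eulerDerivation_linearForm, hform, linearForm_eq_sum v (φ H),
        F.apply_of_mem_N H hH, C_1, ← hx, ← hy, ← hz]
      linear_combination C (φ H (v 0)) * hw' + C (φ H (v 1)) * hwy
    refine ⟨w, g₁, s, ?_⟩
    refine derivation_ext_coord v fun i => ?_
    simp only [Derivation.add_apply, Derivation.smul_apply, smul_eq_mul, hE]
    fin_cases i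
    · change θ x = w * x + g₁ * θ₂ x + s * θ₃ x
      rw [h₂x, h₃x]
      linear_combination hw'
    · change θ y = w * y + g₁ * θ₂ y + s * θ₃ y
      rw [h₂y, h₃y]
      linear_combination hwy
    · change θ z = w * z + g₁ * θ₂ z + s * θ₃ z
      rw [h₂z, h₃z]
      linear_combination hs
  obtain ⟨b, hb₀, hb₁, hb₂⟩ := exists_basis_fin_three A.logDerivations hθ₁mem hθ₂mem hθ₃mem hli hsp
  refine ⟨b, hb₀, ?_, ?_⟩
  · rw [hb₁]
    intro i
    have e : θ₂ (X i) = C (v 0 i) * Q₁ + C (v 1 i) * -Q₀ + C (v 2 i) * h := by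
      simp only [θ₂, Derivation.add_apply, Derivation.smul_apply, smul_eq_mul,
        directionalDerivation, mkDerivation_X]
      ring
    rw [e]
    exact ((((isHomogeneous_directionalDerivation _ hQh).C_mul _).add
      ((isHomogeneous_directionalDerivation _ hQh).neg.C_mul _))).add (hhom.C_mul _)
  · rw [hb₂]
    intro i
    have e : θ₃ (X i) = C (v 2 i) * R := by
      simp only [θ₃, Derivation.smul_apply, smul_eq_mul, directionalDerivation, mkDerivation_X]
      ring
    rw [e]
    exact hRh.C_mul _

end ModularForms

/-! ### A double point on every line missing the modular point -/

theorem eq_zero_of_isHomogeneous_of_dvd {q u : MvPolynomial (Fin 3) K} {n d : ℕ}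
    (hq : q.IsHomogeneous n) (hq0 : q ≠ 0) (hu : u.IsHomogeneous d) (hdn : d < n) (h : q ∣ u) :
    u = 0 := by
  obtain ⟨t, rfl⟩ := h
  by_contra h0
  have ht : t ≠ 0 := right_ne_zero_of_mul h0
  have h1 := hu.totalDegree h0
  rw [totalDegree_mul_of_isDomain hq0 ht, hq.totalDegree hq0] at h1
  omega

namespace ModularForms

variable {A : LineArrangement K} {v : Basis (Fin 3) K (Fin 3 → K)}
  {P N : Finset (Submodule K (Fin 3 → K))} {φ : Submodule K (Fin 3 → K) → Dual K (Fin 3 → K)}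

theorem projection_of_mem_P (F : ModularForms A v P N φ) (ψ : Dual K (Fin 3 → K)) {M}
    (hM : M ∈ P) : projection ψ (v 2) (linearForm (φ M)) = linearForm (φ M) := by
  rw [projection_linearForm, F.apply_of_mem_P M hM, C_0, zero_mul, sub_zero]

/-- There is no plane vector field of degree `|P| - 1`, not proportional to the Euler field, which
is tangent to order two to every line of the pencil `P`. -/
theorem wedge_eq_zero_of_sq_dvd [CharZero K] (F : ModularForms A v P N φ) (hP : 2 ≤ P.card)
    {f g : MvPolynomial (Fin 3) K} (hf : f.IsHomogeneous (P.card - 1))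
    (hg : g.IsHomogeneous (P.card - 1))
    (h : ∀ M ∈ P, linearForm (φ M) ^ 2 ∣ C (φ M (v 0)) * f + C (φ M (v 1)) * g) :
    linearForm (v.coord 0) * g - linearForm (v.coord 1) * f = 0 := by
  -- Differentiating once lowers the order of tangency to one, so Q divides the wedge of the
  -- differentiated field; that wedge has degree `P.card - 1`, less than the degree of Q.
  have hpd : ∀ i, linearForm (v.coord 0) * pderiv i g - linearForm (v.coord 1) * pderiv i f = 0 := by
    intro i
    refine eq_zero_of_isHomogeneous_of_dvd (prod_isHomogeneous φ P)
      (F.prod_ne_zero fun M => F.mem_of_mem_P) (d := 1 + (P.card - 1 - 1))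
      (((linearForm_isHomogeneous _).mul hg.pderiv).sub ((linearForm_isHomogeneous _).mul hf.pderiv))
      (by omega) (F.prod_dvd_wedge fun M hM => ?_)
    obtain ⟨t, ht⟩ := h M hM
    have := congrArg (pderiv i) ht
    rw [map_add, pderiv_C_mul, pderiv_C_mul, Derivation.leibniz, Derivation.leibniz_pow] at this
    rw [this]
    simp only [smul_eq_mul, nsmul_eq_mul]
    exact ⟨linearForm (φ M) * pderiv i t + t * (2 * pderiv i (linearForm (φ M))), by
      push_cast
      ring⟩
  have hf' := hf.sum_X_mul_pderiv
  have hg' := hg.sum_X_mul_pderiv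
  rw [Fin.sum_univ_three, nsmul_eq_mul] at hf' hg'
  -- Euler's formula recovers `f` and `g` from their partial derivatives, up to the factor `P.card -
  -- 1`, which is nonzero as `2 ≤ P.card`.
  have key : ((P.card - 1 : ℕ) : MvPolynomial (Fin 3) K) *
      (linearForm (v.coord 0) * g - linearForm (v.coord 1) * f) = 0 := by
    linear_combination X 0 * hpd 0 + X 1 * hpd 1 + X 2 * hpd 2 - linearForm (v.coord 0) * hg' +
      linearForm (v.coord 1) * hf'
  refine (mul_eq_zero.1 key).resolve_left ?_
  have : P.card - 1 ≠ 0 := by omega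
  exact_mod_cast this

/-- Every line of the arrangement missing the modular point meets some line through the modular
point in a point lying on no further line. -/
theorem exists_line_forall_ne [CharZero K] (F : ModularForms A v P N φ) (hP : 2 ≤ P.card) {H}
    (hH : H ∈ N) : ∃ M ∈ P, ∀ L ∈ N, L ≠ H → ∀ c : K, φ L ≠ φ H + c • φ M := by
  by_contra! hcon
  obtain ⟨h, hhom, hh⟩ := F.exists_vertical_coefficient
  have hQh := prod_isHomogeneous φ P
  have hQ0 : (∏ M ∈ P, linearForm (φ M)) ≠ 0 := F.prod_ne_zero fun M => F.mem_of_mem_P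
  have heuler := F.euler_prod_P
  have hham : ∀ M ∈ P, _ := fun M hM => dvd_hamiltonian v φ (P := P) (M := M) hM
  have hprojQ : projection (φ H) (v 2) (∏ M ∈ P, linearForm (φ M)) =
      ∏ M ∈ P, linearForm (φ M) := by
    rw [map_prod]
    exact Finset.prod_congr rfl fun M hM => F.projection_of_mem_P _ hM
  set Q := ∏ M ∈ P, linearForm (φ M) with hQ
  have hQ₀h := isHomogeneous_directionalDerivation (v 0) hQh
  have hQ₁h := isHomogeneous_directionalDerivation (v 1) hQh
  set Q₀ := directionalDerivation (v 0) Q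
  set Q₁ := directionalDerivation (v 1) Q
  set x := linearForm (v.coord 0) with hx
  set y := linearForm (v.coord 1) with hy
  have hu : (C (φ H (v 0)) * Q₁ + C (φ H (v 1)) * -Q₀ + h).IsHomogeneous (P.card - 2 + 1) := by
    have e : P.card - 2 + 1 = P.card - 1 := by omega
    rw [e]
    exact ((hQ₁h.C_mul _).add (hQ₀h.neg.C_mul _)).add hhom
  -- Here `θ₂(α_H) = α_H t`, so D = θ₂ - t E kills `α_H`. Since `t` has degree `P.card - 2`, D is
  -- homogeneous of degree `P.card - 1`.
  obtain ⟨t, hthom, ht⟩ := exists_isHomogeneous_of_linearForm_dvd hu (hh H hH)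
  have hxhom : ∀ i, (t * linearForm (v.coord i)).IsHomogeneous (P.card - 1) := fun i => by
    have := hthom.mul (linearForm_isHomogeneous (v.coord i))
    rwa [show P.card - 2 + 1 = P.card - 1 by omega] at this
  have hρx : projection (φ H) (v 2) x = x := by rw [hx, projection_linearForm]; simp
  have hρy : projection (φ H) (v 2) y = y := by rw [hy, projection_linearForm]; simp
  have hzero := F.wedge_eq_zero_of_sq_dvd hP
    (projection_isHomogeneous (φ H) (v 2) (hQ₁h.sub (hxhom 0)))
    (projection_isHomogeneous (φ H) (v 2) (hQ₀h.neg.sub (hxhom 1))) (by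
      intro M hM
      obtain ⟨L, hL, hLH, c, hc⟩ := hcon M hM
      have hc0 : c ≠ 0 := by
        rintro rfl
        refine F.ne_smul (F.mem_of_mem_N hH) (F.mem_of_mem_N hL) hLH.symm 1 ?_
        rw [hc, zero_smul, add_zero, one_smul]
      have hα : linearForm (φ L) = linearForm (φ H) + C c * linearForm (φ M) := by
        rw [hc, linearForm_add, linearForm_smul]
      have h1 : linearForm (φ M) ∣ C (φ M (v 0)) * (Q₁ - t * x) + C (φ M (v 1)) * (-Q₀ - t * y) := by
        have e : C (φ M (v 0)) * (Q₁ - t * x) + C (φ M (v 1)) * (-Q₀ - t * y) =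
            (C (φ M (v 0)) * Q₁ + C (φ M (v 1)) * -Q₀) - linearForm (φ M) * t := by
          rw [F.linearForm_of_mem_P hM]
          ring
        rw [e]
        exact dvd_sub (hham M hM) (dvd_mul_right _ _)
      -- Since D kills `α_H` and `α_L = α_H + c α_M`, the value `D(α_L)` is `c D(α_M)`.
      have h2 : linearForm (φ L) ∣ C (φ M (v 0)) * (Q₁ - t * x) + C (φ M (v 1)) * (-Q₀ - t * y) := by
        refine dvd_of_dvd_C_mul hc0 ?_
        have e : C c * (C (φ M (v 0)) * (Q₁ - t * x) + C (φ M (v 1)) * (-Q₀ - t * y)) =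
            (C (φ L (v 0)) * Q₁ + C (φ L (v 1)) * -Q₀ + h) - linearForm (φ L) * t := by
          rw [hα, F.linearForm_of_mem_P hM, hc]
          simp only [LinearMap.add_apply, LinearMap.smul_apply, smul_eq_mul, C_add, C_mul]
          linear_combination -ht
        rw [e]
        exact dvd_sub (hh L hL) (dvd_mul_right _ _)
      have hML : M ≠ L := by
        rintro rfl
        have h3 := F.apply_of_mem_P M hM
        rw [F.apply_of_mem_N M hL] at h3
        exact one_ne_zero h3
      have h3 := (isRelPrime_linearForm (F.ne_zero (F.mem_of_mem_P hM))
        (F.ne_smul (F.mem_of_mem_P hM) (F.mem_of_mem_N hL) hML)).mul_dvd h1 h2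
      -- On `H` the form `α_L` restricts to `c α_M`, so `α_M α_L ∣ D(α_M)` becomes divisibility by
      -- `α_M ^ 2`.
      have h4 := map_dvd (projection (φ H) (v 2)) h3
      rw [map_mul, F.projection_of_mem_P _ hM, projection_linearForm, F.apply_of_mem_N L hL, C_1,
        one_mul, hα, add_sub_cancel_left] at h4
      refine (Dvd.intro_left (C c) ?_ : _ ∣ _).trans (h4.trans (dvd_of_eq ?_))
      · ring
      · simp only [map_add, map_mul, algHom_C, algebraMap_eq]
        rfl)
  -- In the wedge of D the terms with `t` cancel, leaving `-P.card * Q`, which the projection fixes.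
  have hfinal : (P.card : MvPolynomial (Fin 3) K) * Q = 0 := by
    have h5 := congrArg (projection (φ H) (v 2)) heuler
    rw [map_nsmul, hprojQ, nsmul_eq_mul, map_add, map_mul, map_mul, hρx, hρy] at h5
    change x * projection (φ H) (v 2) (-Q₀ - t * y) - y * projection (φ H) (v 2) (Q₁ - t * x) = 0
      at hzero
    rw [map_sub, map_neg, map_sub, map_mul, map_mul, hρx, hρy] at hzero
    linear_combination -h5 - hzero
  refine mul_ne_zero ?_ hQ0 hfinal
  have : P.card ≠ 0 := by omega
  exact_mod_cast this

end ModularForms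

/-! ### Normalized forms from a modular point -/

theorem exists_dual_ker_eq {H : Submodule K (Fin 3 → K)} (hH : finrank K H = 2) :
    ∃ f : Dual K (Fin 3 → K), LinearMap.ker f = H := by
  have hlt : H < ⊤ := lt_top_iff_ne_top.2 fun h => by
    rw [h, finrank_top] at hH
    simp at hH
  obtain ⟨f, hf, hle⟩ := H.exists_le_ker_of_lt_top hlt
  refine ⟨f, (Submodule.eq_of_le_of_finrank_le hle ?_).symm⟩
  have h1 : finrank K (LinearMap.ker f) < finrank K (Fin 3 → K) :=
    Submodule.finrank_lt fun h => hf (LinearMap.ker_eq_top.1 h)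
  simp at h1
  omega

theorem exists_basis_span_eq {p : Submodule K (Fin 3 → K)} (hp : finrank K p = 1) :
    ∃ v : Basis (Fin 3) K (Fin 3 → K), p = K ∙ v 2 := by
  obtain ⟨u, hu, hup⟩ := finrank_eq_one_iff'.1 hp
  have hu0 : (u : Fin 3 → K) ≠ 0 := fun h => hu (Subtype.ext h)
  have hli : LinearIndependent K ![(u : Fin 3 → K)] := by
    rw [linearIndependent_unique_iff]
    exact hu0
  obtain ⟨b, hb⟩ := exists_linearIndependent_cons_of_lt_finrank hli
    (by rw [finrank_fin_fun]; norm_num)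
  obtain ⟨a, ha⟩ := exists_linearIndependent_cons_of_lt_finrank hb
    (by rw [finrank_fin_fun]; norm_num)
  refine ⟨basisOfLinearIndependentOfCardEqFinrank ha (by simp), ?_⟩
  rw [coe_basisOfLinearIndependentOfCardEqFinrank]
  change p = K ∙ (u : Fin 3 → K)
  refine le_antisymm (fun w hw => ?_) ((Submodule.span_singleton_le_iff_mem _ _).2 u.2)
  obtain ⟨c, hc⟩ := hup ⟨w, hw⟩
  exact Submodule.mem_span_singleton.2 ⟨c, congrArg Subtype.val hc⟩

theorem exists_eq_smul_add_smul {f g h : Dual K (Fin 3 → K)}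
    (hle : LinearMap.ker f ⊓ LinearMap.ker g ≤ LinearMap.ker h) :
    ∃ a b : K, h = a • f + b • g := by
  have : h ∈ Submodule.span K (Set.range ![f, g]) := by
    refine mem_span_of_iInf_ker_le_ker (le_trans (fun x hx => ?_) hle)
    rw [Submodule.mem_iInf] at hx
    exact ⟨hx 0, hx 1⟩
  obtain ⟨c, hc⟩ := (Submodule.mem_span_range_iff_exists_fun K).1 this
  exact ⟨c 0, c 1, by rw [← hc, Fin.sum_univ_two]; rfl⟩

theorem mem_linesThrough {A : LineArrangement K} {p H : Submodule K (Fin 3 → K)} :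
    H ∈ A.linesThrough p ↔ H ∈ A.lines ∧ p ≤ H := by
  classical
  exact Finset.mem_filter

theorem finrank_eq_one_of_mem_points {A : LineArrangement K} {p : Submodule K (Fin 3 → K)}
    (hp : p ∈ A.points) : finrank K p = 1 := by
  classical
  exact (Finset.mem_filter.1 hp).2

theorem inf_mem_points {A : LineArrangement K} {H L : Submodule K (Fin 3 → K)}
    (hH : H ∈ A.lines) (hL : L ∈ A.lines) (hHL : H ≠ L) : H ⊓ L ∈ A.points := by
  classical
  refine Finset.mem_filter.2 ⟨Finset.mem_image.2 ⟨{H, L}, ?_, by simp⟩, ?_⟩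
  · rw [Finset.mem_powerset, Finset.insert_subset_iff, Finset.singleton_subset_iff]
    exact ⟨hH, hL⟩
  · have h1 := Submodule.finrank_sup_add_finrank_inf_eq H L
    rw [A.finrank_eq_two H hH, A.finrank_eq_two L hL] at h1
    have h2 : finrank K H < finrank K ↥(H ⊔ L) := by
      refine Submodule.finrank_lt_finrank_of_lt (lt_of_le_of_ne le_sup_left fun h => hHL ?_)
      refine (Submodule.eq_of_le_of_finrank_eq (h ▸ le_sup_right) ?_).symm
      rw [A.finrank_eq_two H hH, A.finrank_eq_two L hL]
    have h3 : finrank K ↥(H ⊔ L) ≤ finrank K (Fin 3 → K) := Submodule.finrank_le _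
    rw [A.finrank_eq_two H hH] at h2
    simp at h3
    omega

open Classical in
/-- A modular point yields normalized defining forms. -/
theorem IsModularPoint.exists_modularForms {A : LineArrangement K} {p : Submodule K (Fin 3 → K)}
    (hp : A.IsModularPoint p) : ∃ v φ, ModularForms A v (A.linesThrough p)
      (A.lines.filter fun H => ¬p ≤ H) φ := by
  obtain ⟨v, hv⟩ := exists_basis_span_eq (finrank_eq_one_of_mem_points hp.1)
  have hle : ∀ H, p ≤ H ↔ v 2 ∈ H := fun H => by
    rw [hv, Submodule.span_singleton_le_iff_mem]
  have hφ : ∀ H, ∃ f : Dual K (Fin 3 → K), H ∈ A.lines →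
      LinearMap.ker f = H ∧ (¬p ≤ H → f (v 2) = 1) := by
    intro H
    by_cases hH : H ∈ A.lines
    · obtain ⟨f, hf⟩ := exists_dual_ker_eq (A.finrank_eq_two H hH)
      by_cases hpH : p ≤ H
      · exact ⟨f, fun _ => ⟨hf, fun h => absurd hpH h⟩⟩
      · have h0 : f (v 2) ≠ 0 := fun h => hpH ((hle H).2 (hf ▸ h))
        refine ⟨(f (v 2))⁻¹ • f, fun _ => ⟨?_, fun _ => ?_⟩⟩
        · rw [LinearMap.ker_smul _ _ (inv_ne_zero h0), hf]
        · simpa using inv_mul_cancel₀ h0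
    · exact ⟨0, fun h => absurd h hH⟩
  choose φ hφ using hφ
  have hP : ∀ M ∈ A.linesThrough p, φ M (v 2) = 0 := fun M hM => by
    obtain ⟨hM, hpM⟩ := mem_linesThrough.1 hM
    have := (hle M).1 hpM
    rwa [← (hφ M hM).1] at this
  have hN : ∀ H ∈ A.lines.filter fun H => ¬p ≤ H, φ H (v 2) = 1 := fun H hH =>
    (hφ H (Finset.mem_filter.1 hH).1).2 (Finset.mem_filter.1 hH).2
  refine ⟨v, φ, ⟨fun H => ?_, fun H hH => (hφ H hH).1, hP, hN, fun H hH L hL hHL => ?_⟩⟩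
  · rw [mem_linesThrough, Finset.mem_filter]
    tauto
  · obtain ⟨hHl, hHp⟩ := Finset.mem_filter.1 hH
    obtain ⟨hLl, hLp⟩ := Finset.mem_filter.1 hL
    obtain ⟨M, ⟨hM, hHLM⟩, -⟩ := hp.2 H hHl L hLl (fun h => hHp (mem_linesThrough.1 h).2)
      (fun h => hLp (mem_linesThrough.1 h).2) hHL
    refine ⟨M, hM, ?_⟩
    have hMl := (mem_linesThrough.1 hM).1
    rw [← (hφ H hHl).1, ← (hφ L hLl).1, ← (hφ M hMl).1] at hHLM
    obtain ⟨a, b, hab⟩ := exists_eq_smul_add_smul hHLM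
    -- Evaluation at `v 2`, where the form of `M` vanishes and those of `H` and `L` take the value
    -- 1.
    have h0 : a + b = 0 := by
      have := LinearMap.congr_fun hab (v 2)
      simpa [hP M hM, hN H hH, hN L hL] using this.symm
    have ha : a = -b := eq_neg_of_add_eq_zero_left h0
    have hb : b ≠ 0 := by
      rintro rfl
      rw [ha, neg_zero, zero_smul, zero_smul, add_zero] at hab
      have h1 := A.finrank_eq_two M hMl
      rw [← (hφ M hMl).1, hab, LinearMap.ker_zero, finrank_top] at h1
      simp at h1
    refine ⟨b⁻¹, ?_⟩
    refine LinearMap.ext fun x => ?_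
    simp only [hab, ha, LinearMap.add_apply, LinearMap.smul_apply, smul_eq_mul]
    field_simp
    ring

/-! ### Counting double points -/

namespace ModularForms

variable {A : LineArrangement K} {v : Basis (Fin 3) K (Fin 3 → K)}
  {P N : Finset (Submodule K (Fin 3 → K))} {φ : Submodule K (Fin 3 → K) → Dual K (Fin 3 → K)}

theorem ne_of_mem (F : ModularForms A v P N φ) {M H} (hM : M ∈ P) (hH : H ∈ N) : M ≠ H := by
  rintro rfl
  have h := F.apply_of_mem_P M hM
  rw [F.apply_of_mem_N M hH] at h
  exact one_ne_zero h

/-- A form vanishing at the intersection is `a • φ M + b • φ H`, and its value at `v 2` is `b`: for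
`b = 0` the line is `M`, and for `b = 1` the hypothesis leaves only `H`. -/
theorem mem_linesThrough_inf (F : ModularForms A v P N φ) {M H} (hM : M ∈ P) (hH : H ∈ N)
    (hMH : ∀ L ∈ N, L ≠ H → ∀ c : K, φ L ≠ φ H + c • φ M) (L : Submodule K (Fin 3 → K)) :
    L ∈ A.linesThrough (M ⊓ H) ↔ L = M ∨ L = H := by
  rw [mem_linesThrough]
  constructor
  · rintro ⟨hL, hle⟩
    by_contra! hne
    have hker := F.ker L hL
    rw [← F.ker M (F.mem_of_mem_P hM), ← F.ker H (F.mem_of_mem_N hH), ← hker] at hle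
    obtain ⟨a, b, hab⟩ := exists_eq_smul_add_smul hle
    have hb : φ L (v 2) = b := by
      have := LinearMap.congr_fun hab (v 2)
      simpa [F.apply_of_mem_P M hM, F.apply_of_mem_N H hH] using this
    rcases (F.mem_lines L).1 hL with hLP | hLN
    · rw [F.apply_of_mem_P L hLP] at hb
      rw [← hb, zero_smul, add_zero] at hab
      exact F.ne_smul (F.mem_of_mem_P hM) hL hne.1.symm a hab
    · rw [F.apply_of_mem_N L hLN] at hb
      rw [← hb, one_smul, add_comm] at hab
      exact hMH L hLN hne.2 a hab
  · rintro (rfl | rfl)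
    · exact ⟨F.mem_of_mem_P hM, inf_le_left⟩
    · exact ⟨F.mem_of_mem_N hH, inf_le_right⟩

open Classical in
-- Each counted pair gives the double point `M ⊓ H`, and the two lines through that point determine
-- the pair, one lying in `P` and the other in `N`.
theorem sum_card_le_numDoublePoints (F : ModularForms A v P N φ) :
    ∑ H ∈ N, (P.filter fun M => ∀ L ∈ N, L ≠ H → ∀ c : K, φ L ≠ φ H + c • φ M).card ≤
      A.numDoublePoints := by
  rw [← Finset.card_sigma, numDoublePoints]
  refine Finset.card_le_card_of_injOn (fun x => x.2 ⊓ x.1) ?_ ?_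
  · rintro ⟨H, M⟩ hx
    obtain ⟨hH, hx⟩ := Finset.mem_sigma.1 hx
    obtain ⟨hM, hMH⟩ := Finset.mem_filter.1 hx
    refine Finset.mem_filter.2 ⟨inf_mem_points (F.mem_of_mem_P hM) (F.mem_of_mem_N hH)
      (F.ne_of_mem hM hH), ?_⟩
    have : A.linesThrough (M ⊓ H) = {M, H} := by
      ext L
      rw [F.mem_linesThrough_inf hM hH hMH, Finset.mem_insert, Finset.mem_singleton]
    rw [mu, this, Finset.card_pair (F.ne_of_mem hM hH)]
    norm_num
  · rintro ⟨H, M⟩ hx ⟨H', M'⟩ hx' heq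
    obtain ⟨hH, hx⟩ := Finset.mem_sigma.1 hx
    obtain ⟨hM, hMH⟩ := Finset.mem_filter.1 hx
    obtain ⟨hH', hx'⟩ := Finset.mem_sigma.1 hx'
    obtain ⟨hM', hMH'⟩ := Finset.mem_filter.1 hx'
    dsimp only at hH hM hMH hH' hM' hMH' heq
    have key := F.mem_linesThrough_inf hM hH hMH
    rw [heq] at key
    have h1 := (key M').1 ((F.mem_linesThrough_inf hM' hH' hMH' M').2 (Or.inl rfl))
    have h2 := (key H').1 ((F.mem_linesThrough_inf hM' hH' hMH' H').2 (Or.inr rfl))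
    have h3 : M' = M := h1.resolve_right (F.ne_of_mem hM' hH)
    have h4 : H' = H := h2.resolve_left (F.ne_of_mem hM hH').symm
    subst h3 h4
    rfl

open Classical in
-- A line `L ≠ H` of `N` meets `H` in a single point, which lies on at most one pencil line; so `L`
-- excludes at most one `M`.
theorem card_le_card_filter_add (F : ModularForms A v P N φ) {H} (hH : H ∈ N) :
    P.card ≤ (P.filter fun M => ∀ L ∈ N, L ≠ H → ∀ c : K, φ L ≠ φ H + c • φ M).card +
      (N.card - 1) := by
  rw [← Finset.card_filter_add_card_filter_not (s := P)
    (fun M => ∀ L ∈ N, L ≠ H → ∀ c : K, φ L ≠ φ H + c • φ M), ← Finset.card_erase_of_mem hH]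
  refine Nat.add_le_add_left ?_ _
  have hex : ∀ M, ∃ L, M ∈ P.filter (fun M => ¬∀ L ∈ N, L ≠ H → ∀ c : K, φ L ≠ φ H + c • φ M) →
      L ∈ N.erase H ∧ ∃ c : K, φ L = φ H + c • φ M := fun M => by
    by_cases hM : M ∈ P.filter (fun M => ¬∀ L ∈ N, L ≠ H → ∀ c : K, φ L ≠ φ H + c • φ M)
    · have h := (Finset.mem_filter.1 hM).2
      push Not at h
      obtain ⟨L, hL, hLH, c, hc⟩ := h
      exact ⟨L, fun _ => ⟨Finset.mem_erase.2 ⟨hLH, hL⟩, c, hc⟩⟩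
    · exact ⟨H, fun h => absurd h hM⟩
  choose f hf using hex
  refine Finset.card_le_card_of_injOn f (fun M hM => (hf M hM).1) fun M hM M' hM' heq => ?_
  by_contra hne
  obtain ⟨hL, c, hc⟩ := hf M hM
  obtain ⟨-, c', hc'⟩ := hf M' hM'
  rw [← heq, hc, add_right_inj] at hc'
  obtain ⟨hLH, hLN⟩ := Finset.mem_erase.1 hL
  have hc0 : c ≠ 0 := by
    rintro rfl
    refine F.ne_smul (F.mem_of_mem_N hH) (F.mem_of_mem_N hLN) hLH.symm 1 ?_
    rw [hc, zero_smul, add_zero, one_smul]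
  refine F.ne_smul (F.mem_of_mem_P (Finset.mem_filter.1 hM').1)
    (F.mem_of_mem_P (Finset.mem_filter.1 hM).1) (Ne.symm hne) (c⁻¹ * c') ?_
  rw [mul_smul, ← hc', inv_smul_smul₀ hc0]

end ModularForms

end LineArrangement

theorem corollary1p4 {K : Type*} [Field K] [CharZero K] (A : LineArrangement K)
    (hA : A.IsSupersolvable) (m k : ℕ) (hcard : A.lines.card = m + k) (hk : 1 ≤ k)
    (p : Submodule K (Fin 3 → K)) (hp : A.IsModularPoint p)
    (hmu : A.mu p = (m : ℤ) - 1) (hm : (1 : ℤ) ≤ (m : ℤ) - 1) :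
    A.IsFreeWithExponents (m - 1) k ∧
      (k ≤ m → (k : ℤ) * ((m : ℤ) - (k : ℤ) + 1) ≤ (A.numDoublePoints : ℤ)) ∧
      (m ≤ k → k ≤ A.numDoublePoints) := by
  classical
  obtain ⟨v, φ, F⟩ := hp.exists_modularForms
  have hP : (A.linesThrough p).card = m := by
    rw [LineArrangement.mu] at hmu
    omega
  have hN : (A.lines.filter fun H => ¬p ≤ H).card = k := by
    have := Finset.card_filter_add_card_filter_not (s := A.lines) (fun H => p ≤ H)
    have h2 : (A.lines.filter fun H => p ≤ H).card = m := hP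
    omega
  have hsum := F.sum_card_le_numDoublePoints
  refine ⟨?_, fun hkm => ?_, fun _ => ?_⟩
  · have := F.isFreeWithExponents (Finset.card_pos.1 (by omega))
    rwa [hP, hN] at this
  -- At most `k - 1` of the `m` pencil lines are excluded for each `H`; with `1 ≤ k ≤ m` both
  -- natural subtractions are exact.
  · have h1 := (Finset.card_nsmul_le_sum _ _ (m - (k - 1)) fun H hH => by
      have := F.card_le_card_filter_add hH
      rw [hP, hN] at this
      omega).trans hsum
    rw [hN, smul_eq_mul] at h1
    have h2 : ((m - (k - 1) : ℕ) : ℤ) = (m : ℤ) - k + 1 := by omega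
    rw [← h2]
    exact_mod_cast h1
  · have h1 := (Finset.card_nsmul_le_sum _ _ 1 fun H hH => by
      obtain ⟨M, hM, hMH⟩ := F.exists_line_forall_ne (by omega) hH
      exact Finset.card_pos.2 ⟨M, Finset.mem_filter.2 ⟨hM, hMH⟩⟩).trans hsum
    rwa [hN, smul_eq_mul, mul_one] at h1
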